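/- Setting. For $n\ge 1$ put $N=2^n$. A gate is a unitary on some finite number of qubits. For every $n$ let $\mathcal G_n$ be a finite set of gates such that, for some constant $k$ and all large $n$, $|\mathcal G_n|\le n^{k}$ and every gate in $\mathcal G_n$ acts on at most $n^{k}$ qubits (for instance, a fixed finite gate set). A circuit over $\mathcal G_n$ is a finite sequence of gates from $\mathcal G_n$, each applied to arbitrary pairwise distinct wires of a register of $n$ input qubits and any number of ancilla qubits. For $n$-qubit pure states $|a\rangle,|b\rangle$ and real $\varepsilon$, the distinguishability complexity $\mathcal D_\varepsilon(|a\rangle,|b\rangle)\in\mathbb N\cup\{\infty\}$ is the minimal number of gates in a circuit $C$ over $\mathcal G_n$ such that $$\Bigl|\,\|\Pi_1 C|a\rangle|0\cdots0\rangle\|_2^2-\|\Pi_1 C|b\rangle|0\cdots0\rangle\|_2^2\Bigr|\ \ge\ 1-\varepsilon ,\qquad \Pi_1=|1\rangle\langle 1|\otimes\mathbb I ,$$ where $\Pi_1$ acts on the first qubit (and $\mathcal D_\varepsilon=\infty$ if there is no such circuit). For nonempty $S\subseteq\{0,1\}^n$ let $|S\rangle=|S|^{-1/2}\sum_{x\in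 S}|x\rangle$ and $\bar S=\{0,1\}^n\setminus S$. Theorem. Let $\varepsilon=\varepsilon(n)>0$ satisfy $\varepsilon=\omega(1/N)$, that is, $1/N=o(\varepsilon)$, and suppose that $1-\varepsilon(n)\ge n^{-k'}$ for some constant $k'$ and all large $n$ (for instance, that $\varepsilon$ is bounded away from $1$). Then for every $n\ge1$ there is a subset $S=S_n\subseteq\{0,1\}^n$ with $|S|=N/2$ such that $$\mathcal D_\varepsilon(|S\rangle,|\bar S\rangle)=\tilde\Omega(N),$$ that is, there are constants $c>0$ and $k''\in\mathbb N$ with $\mathcal D_{\varepsilon(n)}(|S_n\rangle,|\bar S_n\rangle)\ge cN/(\log N)^{k''}$ for all sufficiently large $n$. -/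

import Mathlib

open Filter Asymptotics
open scoped ENNReal

noncomputable section

/-- Amplitude vectors of states on `w` qubits, in the computational basis `{0,1}^w`. -/
abbrev QState (w : ℕ) : Type := (Fin w → Bool) → ℂ

/-- A quantum gate: a unitary acting on `arity` qubits. -/
structure Gate where
  arity : ℕ
  mat : Matrix.unitaryGroup (Fin arity → Bool) ℂ

/-- A gate together with the (ordered, pairwise distinct) wires of a `w`-qubit register
on which it acts. -/
structure PlacedGate (w : ℕ) where
  gate : Gate
  wires : Fin gate.arity ↪ Fin w

/-- The action of a placed gate on a `w`-qubit state: the gate's unitary on the chosen wires,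
tensored with the identity on all the other wires. Here `Function.extend P.wires y x` is the
bit string `x` with the bits on the chosen wires replaced by those of `y`. -/
def PlacedGate.apply {w : ℕ} (P : PlacedGate w) (ψ : QState w) : QState w :=
  fun x => ∑ y : Fin P.gate.arity → Bool,
    P.gate.mat.1 (fun i => x (P.wires i)) y * ψ (Function.extend P.wires y x)

/-- A circuit on `w` wires; the head of the list is the gate that is applied first. -/
abbrev Circuit (w : ℕ) : Type := List (PlacedGate w)

/-- The output state of a circuit on a given input state. -/
def Circuit.run {w : ℕ} (C : Circuit w) (ψ : QState w) : QState w :=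
  C.foldl (fun φ P => P.apply φ) ψ

/-- All gates of the circuit are taken from the gate set `𝒢`. -/
def Circuit.Over {w : ℕ} (C : Circuit w) (𝒢 : Finset Gate) : Prop :=
  ∀ P ∈ C, P.gate ∈ 𝒢

/-- The state `|a⟩|0…0⟩` with `m` ancilla qubits. -/
def withAncillas {n : ℕ} (m : ℕ) (a : QState n) : QState (n + m) :=
  fun x => if ∀ j : Fin m, x (Fin.natAdd n j) = false
    then a (fun i => x (Fin.castAdd m i)) else 0

open Classical in
/-- `‖Π₁ ψ‖²` with `Π₁ = |1⟩⟨1| ⊗ I`: the probability that a measurement of the first qubit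
gives the outcome `1`. -/
def probOne {w : ℕ} (ψ : QState w) : ℝ :=
  ∑ x : Fin w → Bool, if ∃ h : 0 < w, x ⟨0, h⟩ = true then ‖ψ x‖ ^ 2 else 0

/-- The circuit `C` distinguishes `a` and `b` with error `ε`. -/
def Circuit.Distinguishes {n m : ℕ} (C : Circuit (n + m)) (ε : ℝ) (a b : QState n) : Prop :=
  1 - ε ≤ |probOne (C.run (withAncillas m a)) - probOne (C.run (withAncillas m b))|

/-- The distinguishability complexity `D_ε(|a⟩, |b⟩)` over the gate set `𝒢`: the minimal number
of gates in a circuit, with any number of ancillas, that distinguishes `a` and `b` with error `ε`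
(`⊤` if there is no such circuit). -/
def distComplexity (𝒢 : Finset Gate) {n : ℕ} (ε : ℝ) (a b : QState n) : ℕ∞ :=
  sInf {T : ℕ∞ | ∃ (m : ℕ) (C : Circuit (n + m)),
    C.Over 𝒢 ∧ C.Distinguishes ε a b ∧ T = (C.length : ℕ∞)}

/-- The subset state `|S⟩ = |S|^{-1/2} ∑_{x ∈ S} |x⟩`. -/
def subsetState {n : ℕ} (S : Finset (Fin n → Bool)) : QState n :=
  fun x => if x ∈ S then ((1 / Real.sqrt (S.card : ℝ) : ℝ) : ℂ) else 0

/-- `f = Ω̃(g)`: a lower bound of order `g` up to factors polylogarithmic in `g`. -/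
def IsOmegaTilde (f : ℕ → ℕ∞) (g : ℕ → ℝ) : Prop :=
  ∃ c : ℝ, 0 < c ∧ ∃ k : ℕ, ∀ᶠ n in atTop,
    ENNReal.ofReal (c * g n / Real.log (g n) ^ k) ≤ ((f n : ℕ∞) : ℝ≥0∞)

/-- A family of finite gate sets, one for each number `n` of input qubits, of polynomial size:
`n^{O(1)}` gates, each of them acting on `n^{O(1)}` qubits. -/
def IsPolyGateFamily (𝒢 : ℕ → Finset Gate) : Prop :=
  ∃ k : ℕ, ∀ᶠ n in atTop, (𝒢 n).card ≤ n ^ k ∧ ∀ G ∈ 𝒢 n, G.arity ≤ n ^ k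

end

/-! ### Gates and circuits as contractions -/

/-! A random balanced set defeats every small circuit at once, by concentration and a union bound.

Let `s` be the ±1 vector of a balanced `S` and `L` the linear contraction sending an input to the
accepted part of a circuit's output. The two states are `(1 ± s) / (2√|S|)`, so in the difference of
acceptance probabilities the quadratic terms cancel. What remains is `⟨s, w⟩ / |S|` with `w x = Re
⟨L 1, L e_x⟩` and `‖w‖² ≤ N` (`Circuit.exists_weights`). By a Chernoff bound, at most a fraction `2
exp(-δ² N / 8)` of all sets give bias at least `δ` (`card_le_abs_sum_signVec_le`), and balanced sets
make up at least `1 / N` of all sets (`card_balanced_ge`).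

Ancillas that no gate touches can be dropped (`Circuit.exists_few_ancillas`), so `T` gates give only
`exp(T · poly(n))` circuits up to equivalence. With `δ = 1 - ε ≥ n^(-k')` and `T` about `N / n^j`
for suitable `j`, this is beaten by `exp(δ² N / 8)`, and `exists_hard_set` applies. -/

lemma Matrix.sum_norm_sq_mulVec_of_mem_unitaryGroup {ι : Type*} [Fintype ι] [DecidableEq ι]
    (U : Matrix.unitaryGroup ι ℂ) (φ : ι → ℂ) :
    ∑ z, ‖(U.1.mulVec φ) z‖ ^ 2 = ∑ z, ‖φ z‖ ^ 2 := by
  have key : ∀ v : ι → ℂ, ((∑ z, ‖v z‖ ^ 2 : ℝ) : ℂ) = star v ⬝ᵥ v := by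
    intro v
    simp only [dotProduct, Pi.star_apply, Complex.ofReal_sum, Complex.ofReal_pow]
    refine Finset.sum_congr rfl fun z _ => ?_
    rw [← Complex.conj_mul']
    rfl
  apply Complex.ofReal_injective
  rw [key, key, Matrix.star_mulVec, ← Matrix.dotProduct_mulVec, Matrix.mulVec_mulVec]
  have h : U.1.conjTranspose * U.1 = 1 := Matrix.mem_unitaryGroup_iff'.1 U.2
  rw [h, Matrix.one_mulVec]

lemma extend_extend_of_embedding {α β γ : Type*} (f : α ↪ β) (y z : α → γ) (x : β → γ) :
    Function.extend f y (Function.extend f z x) = Function.extend f y x := by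
  funext b
  by_cases h : ∃ a, f a = b
  · obtain ⟨a, rfl⟩ := h
    simp [f.injective.extend_apply]
  · rw [Function.extend_apply' _ _ _ h, Function.extend_apply' _ _ _ h,
      Function.extend_apply' _ _ _ h]

lemma extend_comp_self {α β γ : Type*} (f : α ↪ β) (x : β → γ) :
    Function.extend f (fun a => x (f a)) x = x := by
  funext b
  by_cases h : ∃ a, f a = b
  · obtain ⟨a, rfl⟩ := h
    simp [f.injective.extend_apply]
  · rw [Function.extend_apply' _ _ _ h]

/-- Resampling the bits in the range of `f` leaves the uniform sum invariant. -/
lemma sum_sum_extend {a w : ℕ} (f : Fin a ↪ Fin w) (g : (Fin w → Bool) → ℝ) :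
    ∑ x : Fin w → Bool, ∑ z : Fin a → Bool, g (Function.extend f z x)
      = 2 ^ a * ∑ x, g x := by
  -- Swapping the bits of `x` on the range of `f` with `z` is an involution on pairs.
  let s : (Fin w → Bool) × (Fin a → Bool) → (Fin w → Bool) × (Fin a → Bool) :=
    fun p => (Function.extend f p.2 p.1, fun i => p.1 (f i))
  have hs : Function.Involutive s := by
    rintro ⟨x, z⟩
    refine Prod.ext ?_ ?_
    · simp only [s]
      rw [extend_extend_of_embedding, extend_comp_self]
    · funext i
      simp [s, f.injective.extend_apply]
  rw [← Fintype.sum_prod_type' (f := fun x z => g (Function.extend f z x))]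
  have := Equiv.sum_comp hs.toPerm (fun p => g p.1)
  simp only [Function.Involutive.coe_toPerm, s] at this
  rw [this, Fintype.sum_prod_type]
  simp [Finset.mul_sum]

lemma PlacedGate.sum_norm_sq_apply {w : ℕ} (P : PlacedGate w) (ψ : QState w) :
    ∑ x, ‖P.apply ψ x‖ ^ 2 = ∑ x, ‖ψ x‖ ^ 2 := by
  -- After resampling the gate's wires on both sides, for each fixed `x` the inner sum is the norm
  -- of a vector on those wires alone, which the unitary preserves.
  have h2 : (2 : ℝ) ^ P.gate.arity ≠ 0 := by positivity
  refine mul_left_cancel₀ h2 ?_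
  rw [← sum_sum_extend P.wires, ← sum_sum_extend P.wires]
  refine Finset.sum_congr rfl fun x _ => ?_
  rw [← Matrix.sum_norm_sq_mulVec_of_mem_unitaryGroup P.gate.mat
    (fun z => ψ (Function.extend P.wires z x))]
  refine Finset.sum_congr rfl fun z _ => ?_
  simp only [PlacedGate.apply, Matrix.mulVec, dotProduct, extend_extend_of_embedding,
    P.wires.injective.extend_apply]

lemma Circuit.run_cons {w : ℕ} (P : PlacedGate w) (C : Circuit w) (ψ : QState w) :
    Circuit.run (P :: C) ψ = Circuit.run C (P.apply ψ) := rfl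

lemma Circuit.sum_norm_sq_run {w : ℕ} (C : Circuit w) (ψ : QState w) :
    ∑ x, ‖C.run ψ x‖ ^ 2 = ∑ x, ‖ψ x‖ ^ 2 := by
  induction C generalizing ψ with
  | nil => rfl
  | cons P C ih => rw [Circuit.run_cons, ih, P.sum_norm_sq_apply]

lemma PlacedGate.apply_add {w : ℕ} (P : PlacedGate w) (ψ φ : QState w) :
    P.apply (ψ + φ) = P.apply ψ + P.apply φ := by
  funext x
  simp [PlacedGate.apply, mul_add, Finset.sum_add_distrib]

lemma PlacedGate.apply_smul {w : ℕ} (P : PlacedGate w) (c : ℂ) (ψ : QState w) :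
    P.apply (c • ψ) = c • P.apply ψ := by
  funext x
  simp [PlacedGate.apply, Finset.mul_sum, mul_left_comm]

lemma Circuit.run_add {w : ℕ} (C : Circuit w) (ψ φ : QState w) :
    C.run (ψ + φ) = C.run ψ + C.run φ := by
  induction C generalizing ψ φ with
  | nil => rfl
  | cons P C ih => simp only [Circuit.run_cons, P.apply_add, ih]

lemma Circuit.run_smul {w : ℕ} (C : Circuit w) (c : ℂ) (ψ : QState w) :
    C.run (c • ψ) = c • C.run ψ := by
  induction C generalizing ψ with
  | nil => rfl
  | cons P C ih => simp only [Circuit.run_cons, P.apply_smul, ih]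

/-! ### Relabelling wires -/

/-- The gate `P`, with its wires relabelled along `e`. -/
def PlacedGate.relabel {v w : ℕ} (e : Fin v ↪ Fin w) (P : PlacedGate v) : PlacedGate w :=
  ⟨P.gate, P.wires.trans e⟩

open Classical in
/-- The state `ψ` on the wires in the range of `e`, tensored with `|0⟩` on all other wires. -/
noncomputable def padState {v w : ℕ} (e : Fin v ↪ Fin w) (ψ : QState v) : QState w :=
  fun x => if ∀ j, j ∉ Set.range e → x j = false then ψ (fun i => x (e i)) else 0

lemma PlacedGate.relabel_apply_padState {v w : ℕ} (e : Fin v ↪ Fin w) (P : PlacedGate v)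
    (ψ : QState v) : (P.relabel e).apply (padState e ψ) = padState e (P.apply ψ) := by
  obtain ⟨G, f⟩ := P
  funext x
  have hout : ∀ (y : Fin G.arity → Bool) (j : Fin w), j ∉ Set.range e →
      Function.extend (f.trans e) y x j = x j := by
    intro y j hj
    refine Function.extend_apply' _ _ _ ?_
    rintro ⟨a, rfl⟩
    exact hj ⟨f a, rfl⟩
  have hin : ∀ y : Fin G.arity → Bool,
      (fun i => Function.extend (f.trans e) y x (e i))
        = Function.extend f y (fun i => x (e i)) := by
    intro y
    funext i
    by_cases h : ∃ a, f a = i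
    · obtain ⟨a, rfl⟩ := h
      rw [f.injective.extend_apply]
      exact (f.trans e).injective.extend_apply y x a
    · rw [Function.extend_apply' _ _ _ h, Function.extend_apply']
      rintro ⟨a, ha⟩
      exact h ⟨a, e.injective ha⟩
  have hcond : ∀ y : Fin G.arity → Bool,
      (∀ j, j ∉ Set.range e → Function.extend (f.trans e) y x j = false)
        ↔ ∀ j, j ∉ Set.range e → x j = false := fun y =>
    forall₂_congr fun j hj => by rw [hout y j hj]
  change ∑ y, G.mat.1 (fun i => x (e (f i))) y * padState e ψ (Function.extend (f.trans e) y x)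
    = padState e (fun x => ∑ y, G.mat.1 (fun i => x (f i)) y * ψ (Function.extend f y x)) x
  simp only [padState]
  by_cases h : ∀ j, j ∉ Set.range e → x j = false
  · rw [if_pos h]
    refine Finset.sum_congr rfl fun y _ => ?_
    rw [if_pos ((hcond y).2 h), hin]
  · rw [if_neg h]
    refine Finset.sum_eq_zero fun y _ => ?_
    rw [if_neg (mt (hcond y).1 h), mul_zero]

lemma Circuit.run_relabel_padState {v w : ℕ} (e : Fin v ↪ Fin w) (C : Circuit v)
    (ψ : QState v) :
    Circuit.run (C.map (PlacedGate.relabel e)) (padState e ψ) = padState e (C.run ψ) := by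
  induction C generalizing ψ with
  | nil => rfl
  | cons P C ih =>
    rw [List.map_cons, Circuit.run_cons, P.relabel_apply_padState, ih, Circuit.run_cons]

/-- The padded state is supported on the zero-extensions of strings on the small register. The
predicates let one lemma serve both `probOne` and the full norm. -/
lemma sum_padState {v w : ℕ} (e : Fin v ↪ Fin w) (ψ : QState v)
    (p : (Fin w → Bool) → Prop) (q : (Fin v → Bool) → Prop) [DecidablePred p] [DecidablePred q]
    (hpq : ∀ x, p x ↔ q (fun i => x (e i))) :
    ∑ x, (if p x then ‖padState e ψ x‖ ^ 2 else 0) = ∑ x, if q x then ‖ψ x‖ ^ 2 else 0 := by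
  symm
  have hext : ∀ x : Fin v → Bool,
      (fun i => Function.extend e x (fun _ => false) (e i)) = x := fun x => by
    funext i; rw [e.injective.extend_apply]
  refine Finset.sum_of_injOn (fun x => Function.extend e x (fun _ => false)) ?_ ?_ ?_ ?_
  · intro x _ y _ hxy
    rw [← hext x, ← hext y]
    simp only at hxy
    rw [hxy]
  · simp
  · intro x _ hx
    have : ¬ ∀ j, j ∉ Set.range e → x j = false := by
      intro h
      apply hx
      refine ⟨fun i => x (e i), by simp, ?_⟩
      funext j
      by_cases hj : ∃ i, e i = j
      · obtain ⟨i, rfl⟩ := hj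
        simp [e.injective.extend_apply]
      · simp only [Function.extend_apply' _ _ _ hj]
        exact (h j hj).symm
    simp only [padState, if_neg this, norm_zero, ne_eq, OfNat.ofNat_ne_zero,
      not_false_eq_true, zero_pow, ite_self]
  · intro x _
    have h1 : ∀ j, j ∉ Set.range e → Function.extend e x (fun _ => false) j = false :=
      fun j hj => Function.extend_apply' _ _ _ hj
    simp only [hpq, hext, padState, if_pos h1]

lemma probOne_padState {v w : ℕ} (e : Fin v ↪ Fin w) (hv : 0 < v) (hw : 0 < w)
    (he : e ⟨0, hv⟩ = ⟨0, hw⟩) (ψ : QState v) : probOne (padState e ψ) = probOne ψ := by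
  classical
  unfold probOne
  refine sum_padState e ψ _ _ fun x => ?_
  simp [hv, hw, he]

lemma withAncillas_eq_padState {n m m' : ℕ} (e : Fin m' ↪ Fin m)
    (E : Fin (n + m') ↪ Fin (n + m)) (hE₁ : ∀ i, E (Fin.castAdd m' i) = Fin.castAdd m i)
    (hE₂ : ∀ j, E (Fin.natAdd n j) = Fin.natAdd n (e j)) (a : QState n) :
    withAncillas m a = padState E (withAncillas m' a) := by
  funext x
  simp only [withAncillas, padState, hE₁, hE₂]
  by_cases h : ∀ j, x (Fin.natAdd n j) = false
  · rw [if_pos h, if_pos, if_pos]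
    · exact fun j => h _
    · intro j hj
      induction j using Fin.addCases with
      | left i => exact absurd ⟨_, hE₁ i⟩ hj
      | right i => exact h i
  · rw [if_neg h]
    by_cases h2 : ∀ j, j ∉ Set.range E → x j = false
    · rw [if_pos h2, if_neg]
      intro h3
      apply h
      intro j
      by_cases hj : Fin.natAdd n j ∈ Set.range E
      · obtain ⟨i, hi⟩ := hj
        induction i using Fin.addCases with
        | left i =>
          rw [hE₁] at hi
          have := congrArg Fin.val hi
          simp at this
          omega
        | right i => rw [← hi, hE₂]; exact h3 i
      · exact h2 _ hj
    · rw [if_neg h2]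

/-- A circuit with few gates of small arity is equivalent to one with few ancillas. -/
lemma Circuit.exists_few_ancillas {n m K : ℕ} (hn : 0 < n) {𝒢 : Finset Gate}
    (hK : ∀ G ∈ 𝒢, G.arity ≤ K) (C : Circuit (n + m)) (hC : C.Over 𝒢) :
    ∃ m' ≤ C.length * K, ∃ C' : Circuit (n + m'), C'.Over 𝒢 ∧ C'.length = C.length ∧
      ∀ a : QState n, probOne (C.run (withAncillas m a))
        = probOne (C'.run (withAncillas m' a)) := by
  classical
  let U : List (PlacedGate (n + m)) → Finset (Fin (n + m)) := fun C =>
    C.toFinset.biUnion fun P => Finset.univ.map P.wires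
  -- Only ancillas touched by some gate are kept. All input wires stay in place, so the measured
  -- qubit is still the first.
  let A : Finset (Fin m) := Finset.univ.filter fun j => Fin.natAdd n j ∈ U C
  have hA : A.card ≤ C.length * K := by
    have h1 : A.card ≤ (U C).card :=
      Finset.card_le_card_of_injOn (Fin.natAdd n) (fun j hj => by simpa [A] using hj)
        (fun a _ b _ h => by simpa using h)
    refine h1.trans ((Finset.card_biUnion_le_card_mul _ _ K ?_).trans ?_)
    · intro P hP
      simpa using hK _ (hC P (List.mem_toFinset.1 hP))
    · exact Nat.mul_le_mul_right _ C.toFinset_card_le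
  let e : Fin A.card ↪ Fin m := (A.orderEmbOfFin rfl).toEmbedding
  let f : Fin (n + A.card) → Fin (n + m) :=
    Fin.addCases (fun i => Fin.castAdd m i) (fun j => Fin.natAdd n (e j))
  have hf₁ : ∀ i, f (Fin.castAdd _ i) = Fin.castAdd m i := fun i => by simp [f]
  have hf₂ : ∀ j, f (Fin.natAdd n j) = Fin.natAdd n (e j) := fun j => by simp [f]
  have hf : Function.Injective f := by
    intro x y hxy
    induction x using Fin.addCases with
    | left i =>
      induction y using Fin.addCases with
      | left j => rw [hf₁, hf₁] at hxy; simpa using hxy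
      | right j =>
        rw [hf₁, hf₂] at hxy
        have := congrArg Fin.val hxy
        simp at this; omega
    | right i =>
      induction y using Fin.addCases with
      | left j =>
        rw [hf₁, hf₂] at hxy
        have := congrArg Fin.val hxy
        simp at this; omega
      | right j => rw [hf₂, hf₂] at hxy; simpa using hxy
  let E : Fin (n + A.card) ↪ Fin (n + m) := ⟨f, hf⟩
  have hrange : ∀ P ∈ C, ∀ i, P.wires i ∈ Set.range E := by
    intro P hP i
    have hmem : P.wires i ∈ U C :=
      Finset.mem_biUnion.2 ⟨P, List.mem_toFinset.2 hP, by simp⟩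
    generalize P.wires i = x at hmem
    induction x using Fin.addCases with
    | left j => exact ⟨_, hf₁ j⟩
    | right j =>
      have hj : j ∈ A := by simpa [A] using hmem
      have : j ∈ Set.range (A.orderEmbOfFin rfl) := by simpa using hj
      obtain ⟨l, hl⟩ := this
      refine ⟨Fin.natAdd n l, ?_⟩
      rw [← hl]
      exact hf₂ l
  have hlift : ∀ P ∈ C, ∃ P' : PlacedGate (n + A.card), P'.relabel E = P := by
    intro P hP
    choose g hg using hrange P hP
    refine ⟨⟨P.gate, ⟨g, fun a b hab => P.wires.injective ?_⟩⟩, ?_⟩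
    · rw [← hg, ← hg, hab]
    · cases P
      simp only [PlacedGate.relabel]
      congr 1
      ext i
      exact congrArg Fin.val (hg i)
  obtain ⟨C', hC'⟩ : C ∈ Set.range (List.map (PlacedGate.relabel E)) := by
    rw [Set.range_list_map]
    exact fun P hP => hlift P hP
  refine ⟨A.card, hA, C', ?_, by rw [← hC', List.length_map], ?_⟩
  · intro P hP
    exact hC (P.relabel E) (hC' ▸ List.mem_map_of_mem hP)
  · intro a
    have hrun : C.run (withAncillas m a) = padState E (Circuit.run C' (withAncillas _ a)) := by
      rw [withAncillas_eq_padState e E hf₁ hf₂, ← Circuit.run_relabel_padState]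
      exact congrArg (fun D => Circuit.run D _) hC'.symm
    rw [hrun, probOne_padState E (by omega) (by omega)]
    exact hf₁ ⟨0, hn⟩

/-! ### The acceptance bias is linear in the sign vector -/

/-- The sign vector of a set: `1` on `S` and `-1` off `S`. -/
noncomputable def signVec {ι : Type*} [DecidableEq ι] (S : Finset ι) : ι → ℝ :=
  fun x => if x ∈ S then 1 else -1

/-- By polarization the difference is `4 Re ⟨L 1, L s⟩`, which is real-linear in `s`. -/
lemma exists_weights_of_contraction {ι E : Type*} [Fintype ι] [NormedAddCommGroup E]
    [InnerProductSpace ℂ E] (L : (ι → ℂ) →ₗ[ℂ] E) (hL : ∀ a, ‖L a‖ ^ 2 ≤ ∑ x, ‖a x‖ ^ 2) :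
    ∃ w : ι → ℝ, ∑ x, w x ^ 2 ≤ Fintype.card ι ∧ ∀ s : ι → ℝ,
      ‖L (fun x => 1 + (s x : ℂ))‖ ^ 2 - ‖L (fun x => 1 - (s x : ℂ))‖ ^ 2
        = 4 * ∑ x, s x * w x := by
  classical
  let o : ι → ℂ := fun _ => 1
  let w : ι → ℝ := fun x => (inner ℂ (L o) (L (Pi.single x 1))).re
  have hlin : ∀ s : ι → ℝ, (inner ℂ (L o) (L (fun x => (s x : ℂ)))).re = ∑ x, s x * w x := by
    intro s
    rw [pi_eq_sum_univ' (fun x => (s x : ℂ)), map_sum, inner_sum, Complex.re_sum]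
    refine Finset.sum_congr rfl fun x _ => ?_
    rw [map_smul, inner_smul_right, Complex.re_ofReal_mul]
  refine ⟨w, ?_, fun s => ?_⟩
  · have h1 : ‖L o‖ ^ 2 ≤ Fintype.card ι := (hL o).trans (by simp [o])
    have h2 : ‖L (fun x => (w x : ℂ))‖ ^ 2 ≤ ∑ x, w x ^ 2 := (hL _).trans (by simp)
    -- Testing the functional on its own coefficient vector gives `‖w‖² ≤ ‖L 1‖ ‖L w‖`; AM-GM and
    -- contractivity then bound this by half of `card ι + ‖w‖²`.
    have h3 : ∑ x, w x ^ 2 ≤ ‖L o‖ * ‖L (fun x => (w x : ℂ))‖ := by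
      calc ∑ x, w x ^ 2 = (inner ℂ (L o) (L (fun x => (w x : ℂ)))).re := by
            rw [hlin]; simp [sq]
        _ ≤ ‖inner ℂ (L o) (L (fun x => (w x : ℂ)))‖ := Complex.re_le_norm _
        _ ≤ _ := norm_inner_le_norm _ _
    nlinarith [sq_nonneg (‖L o‖ - ‖L (fun x => (w x : ℂ))‖)]
  · have e1 : (fun x => 1 + (s x : ℂ)) = o + fun x => (s x : ℂ) := rfl
    have e2 : (fun x => 1 - (s x : ℂ)) = o - fun x => (s x : ℂ) := rfl
    have h1 := norm_add_sq (𝕜 := ℂ) (L o) (L (fun x => (s x : ℂ)))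
    have h2 := norm_sub_sq (𝕜 := ℂ) (L o) (L (fun x => (s x : ℂ)))
    rw [e1, e2, map_add, map_sub, h1, h2, ← hlin]
    simp only [RCLike.re_to_complex]
    ring

lemma withAncillas_add {n : ℕ} (m : ℕ) (a b : QState n) :
    withAncillas m (a + b) = withAncillas m a + withAncillas m b := by
  funext x
  by_cases h : ∀ j : Fin m, x (Fin.natAdd n j) = false <;> simp [withAncillas, h]

lemma withAncillas_smul {n : ℕ} (m : ℕ) (c : ℂ) (a : QState n) :
    withAncillas m (c • a) = c • withAncillas m a := by
  funext x
  by_cases h : ∀ j : Fin m, x (Fin.natAdd n j) = false <;> simp [withAncillas, h]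

lemma sum_norm_sq_withAncillas {n : ℕ} (m : ℕ) (a : QState n) :
    ∑ x, ‖withAncillas m a x‖ ^ 2 = ∑ x, ‖a x‖ ^ 2 := by
  classical
  have h : withAncillas m a = padState (Fin.castAddEmb m) a := by
    funext x
    simp only [withAncillas, padState]
    congr 1
    refine propext ⟨fun h j hj => ?_, fun h j => h _ ?_⟩
    · induction j using Fin.addCases with
      | left i => exact absurd ⟨i, rfl⟩ hj
      | right i => exact h i
    · rintro ⟨i, hi⟩
      have := congrArg Fin.val hi
      simp at this
      omega
  rw [h]
  simpa using sum_padState (Fin.castAddEmb m) a (fun _ => True) (fun _ => True) (by simp)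

open Classical in
/-- The unnormalised state after a circuit on `|a⟩|0…0⟩` and the outcome `1` on the first qubit,
as a linear function of `a`. -/
noncomputable def Circuit.accept {n m : ℕ} (C : Circuit (n + m)) :
    QState n →ₗ[ℂ] EuclideanSpace ℂ (Fin (n + m) → Bool) where
  toFun a := WithLp.toLp 2 fun x =>
    if ∃ h : 0 < n + m, x ⟨0, h⟩ = true then C.run (withAncillas m a) x else 0
  map_add' a b := by
    ext x
    simp only [withAncillas_add, Circuit.run_add, PiLp.add_apply, Pi.add_apply]
    split_ifs <;> simp
  map_smul' c a := by
    ext x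
    simp only [withAncillas_smul, Circuit.run_smul, PiLp.smul_apply, Pi.smul_apply,
      RingHom.id_apply]
    split_ifs <;> simp

lemma Circuit.norm_sq_accept {n m : ℕ} (C : Circuit (n + m)) (a : QState n) :
    ‖C.accept a‖ ^ 2 = probOne (C.run (withAncillas m a)) := by
  classical
  rw [EuclideanSpace.norm_sq_eq]
  unfold probOne
  refine Finset.sum_congr rfl fun x _ => ?_
  simp only [Circuit.accept, LinearMap.coe_mk, AddHom.coe_mk]
  split_ifs <;> simp

lemma Circuit.norm_sq_accept_le {n m : ℕ} (C : Circuit (n + m)) (a : QState n) :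
    ‖C.accept a‖ ^ 2 ≤ ∑ x, ‖a x‖ ^ 2 := by
  classical
  rw [C.norm_sq_accept, ← sum_norm_sq_withAncillas m a, ← C.sum_norm_sq_run]
  unfold probOne
  refine Finset.sum_le_sum fun x _ => ?_
  split_ifs
  · exact le_rfl
  · positivity

lemma subsetState_eq_smul {n : ℕ} (S : Finset (Fin n → Bool)) :
    subsetState S = ((1 / (2 * Real.sqrt S.card) : ℝ) : ℂ) •
      (fun x => 1 + (signVec S x : ℂ) : QState n) := by
  funext x
  by_cases h : x ∈ S
  · simp only [subsetState, signVec, h, if_true, Pi.smul_apply, smul_eq_mul]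
    push_cast
    rw [one_div, one_div, mul_inv]
    ring
  · simp [subsetState, signVec, h]

lemma subsetState_compl_eq_smul {n : ℕ} (S : Finset (Fin n → Bool)) (h : Sᶜ.card = S.card) :
    subsetState Sᶜ = ((1 / (2 * Real.sqrt S.card) : ℝ) : ℂ) •
      (fun x => 1 - (signVec S x : ℂ) : QState n) := by
  rw [subsetState_eq_smul, h]
  congr 1
  funext x
  by_cases hx : x ∈ S <;> simp [signVec, hx]

/-- On balanced sets, the acceptance bias of a circuit is a linear function of the sign vector,
with coefficients of small `ℓ²` norm. -/
lemma Circuit.exists_weights {n m : ℕ} (C : Circuit (n + m)) :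
    ∃ w : (Fin n → Bool) → ℝ, ∑ x, w x ^ 2 ≤ 2 ^ n ∧
      ∀ S : Finset (Fin n → Bool), Sᶜ.card = S.card →
        probOne (C.run (withAncillas m (subsetState S)))
          - probOne (C.run (withAncillas m (subsetState Sᶜ)))
          = (∑ x, signVec S x * w x) / S.card := by
  obtain ⟨w, hw, h⟩ := exists_weights_of_contraction C.accept C.norm_sq_accept_le
  refine ⟨w, by simpa using hw, fun S hS => ?_⟩
  rw [← C.norm_sq_accept, ← C.norm_sq_accept, subsetState_compl_eq_smul S hS,
    subsetState_eq_smul, map_smul, map_smul, norm_smul, norm_smul, mul_pow, mul_pow, ← mul_sub,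
    h, Complex.norm_real, Real.norm_eq_abs, sq_abs, div_pow, mul_pow,
    Real.sq_sqrt (Nat.cast_nonneg _)]
  rcases eq_or_ne (S.card : ℝ) 0 with h0 | h0
  · simp [h0]
  · field_simp
    ring

/-! ### Concentration -/

/-- The sum over subsets factors as `∏ (e^w + e^(-w))`, and `cosh w ≤ e^(w²/2)`. -/
lemma sum_exp_signVec {ι : Type*} [Fintype ι] [DecidableEq ι] (w : ι → ℝ) :
    ∑ S : Finset ι, Real.exp (∑ x, signVec S x * w x)
      ≤ 2 ^ Fintype.card ι * Real.exp ((∑ x, w x ^ 2) / 2) := by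
  have h : ∀ S : Finset ι, Real.exp (∑ x, signVec S x * w x)
      = (∏ x ∈ S, Real.exp (w x)) * ∏ x ∈ Finset.univ \ S, Real.exp (-w x) := by
    intro S
    rw [Real.exp_sum, ← Finset.prod_sdiff (Finset.subset_univ S), mul_comm]
    congr 1
    · exact Finset.prod_congr rfl fun x hx => by simp [signVec, hx]
    · exact Finset.prod_congr rfl fun x hx => by
        simp [signVec, (Finset.mem_sdiff.1 hx).2]
  simp_rw [h]
  rw [← Finset.powerset_univ, ← Finset.prod_add, Finset.sum_div, Real.exp_sum,
    ← Finset.card_univ, ← Finset.prod_const, ← Finset.prod_mul_distrib]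
  refine Finset.prod_le_prod (fun x _ => by positivity) fun x _ => ?_
  have := Real.cosh_le_exp_half_sq (w x)
  rw [Real.cosh_eq] at this
  linarith

lemma card_le_sum_signVec_le {ι : Type*} [Fintype ι] [DecidableEq ι] (w : ι → ℝ) {V t : ℝ}
    (hV : 0 < V) (ht : 0 ≤ t) (hw : ∑ x, w x ^ 2 ≤ V) :
    ((Finset.univ.filter fun S : Finset ι => t ≤ ∑ x, signVec S x * w x).card : ℝ)
      ≤ 2 ^ Fintype.card ι * Real.exp (-(t ^ 2 / (2 * V))) := by
  -- The multiplier `t / V` minimises the Chernoff exponent `λ² V / 2 - λ t`.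
  have h1 := sum_exp_signVec (fun x => t / V * w x)
  have h2 : ((Finset.univ.filter fun S : Finset ι => t ≤ ∑ x, signVec S x * w x).card : ℝ)
      * Real.exp (t ^ 2 / V) ≤ ∑ S : Finset ι, Real.exp (∑ x, signVec S x * (t / V * w x)) := by
    rw [← nsmul_eq_mul]
    refine (Finset.card_nsmul_le_sum _ _ _ fun S hS => ?_).trans
      (Finset.sum_le_sum_of_subset_of_nonneg (Finset.filter_subset _ _)
        fun _ _ _ => (Real.exp_pos _).le)
    rw [Real.exp_le_exp]
    have : ∑ x, signVec S x * (t / V * w x) = t / V * ∑ x, signVec S x * w x := by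
      rw [Finset.mul_sum]; exact Finset.sum_congr rfl fun x _ => by ring
    rw [this, sq, mul_div_right_comm]
    exact mul_le_mul_of_nonneg_left (Finset.mem_filter.1 hS).2 (by positivity)
  have h3 : (∑ x, (t / V * w x) ^ 2) / 2 ≤ t ^ 2 / V + -(t ^ 2 / (2 * V)) := by
    have : ∑ x, (t / V * w x) ^ 2 = (t / V) ^ 2 * ∑ x, w x ^ 2 := by
      rw [Finset.mul_sum]; exact Finset.sum_congr rfl fun x _ => by ring
    rw [this]
    have := mul_le_mul_of_nonneg_left hw (sq_nonneg (t / V))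
    have e : (t / V) ^ 2 * V = t ^ 2 / V := by field_simp
    have e' : t ^ 2 / (2 * V) = t ^ 2 / V / 2 := by field_simp
    rw [e']
    linarith
  have h4 := h2.trans (h1.trans (mul_le_mul_of_nonneg_left (Real.exp_le_exp.2 h3)
    (by positivity)))
  rw [Real.exp_add, mul_comm (Real.exp _), ← mul_assoc] at h4
  exact le_of_mul_le_mul_right h4 (Real.exp_pos _)

lemma card_le_abs_sum_signVec_le {ι : Type*} [Fintype ι] [DecidableEq ι] (w : ι → ℝ) {V t : ℝ}
    (hV : 0 < V) (ht : 0 ≤ t) (hw : ∑ x, w x ^ 2 ≤ V) :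
    ((Finset.univ.filter fun S : Finset ι => t ≤ |∑ x, signVec S x * w x|).card : ℝ)
      ≤ 2 * 2 ^ Fintype.card ι * Real.exp (-(t ^ 2 / (2 * V))) := by
  have h1 := card_le_sum_signVec_le w hV ht hw
  have h2 := card_le_sum_signVec_le (fun x => -w x) hV ht (by simpa using hw)
  have h3 : (Finset.univ.filter fun S : Finset ι => t ≤ |∑ x, signVec S x * w x|)
      ⊆ (Finset.univ.filter fun S : Finset ι => t ≤ ∑ x, signVec S x * w x)
        ∪ (Finset.univ.filter fun S : Finset ι => t ≤ ∑ x, signVec S x * (-w x)) := by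
    intro S hS
    simpa [le_abs] using hS
  have h4 : (_ : ℝ) ≤ _ := Nat.cast_le.2 ((Finset.card_le_card h3).trans (Finset.card_union_le _ _))
  push_cast at h4
  linarith

/-! ### Counting circuits -/

open Classical in
/-- All placed gates from `𝒢` on `w` wires. -/
noncomputable def placedGates (𝒢 : Finset Gate) (w : ℕ) : Finset (PlacedGate w) :=
  (𝒢.sigma fun G => (Finset.univ : Finset (Fin G.arity ↪ Fin w))).image fun p => ⟨p.1, p.2⟩

lemma mem_placedGates {𝒢 : Finset Gate} {w : ℕ} {P : PlacedGate w} (h : P.gate ∈ 𝒢) :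
    P ∈ placedGates 𝒢 w := by
  classical
  exact Finset.mem_image.2 ⟨⟨P.gate, P.wires⟩, by simpa using h, rfl⟩

lemma card_placedGates_le {𝒢 : Finset Gate} {w K : ℕ} (hw : 0 < w)
    (hK : ∀ G ∈ 𝒢, G.arity ≤ K) : (placedGates 𝒢 w).card ≤ 𝒢.card * w ^ K := by
  classical
  refine Finset.card_image_le.trans ?_
  rw [Finset.card_sigma]
  refine (Finset.sum_le_card_nsmul _ _ (w ^ K) fun G hG => ?_).trans_eq (smul_eq_mul _ _)
  rw [Finset.card_univ, Fintype.card_embedding_eq, Fintype.card_fin, Fintype.card_fin]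
  exact (Nat.descFactorial_le_pow _ _).trans (Nat.pow_le_pow_right hw (hK G hG))

open Classical in
/-- All circuits over `𝒢` on `w` wires with at most `T` gates. -/
noncomputable def circuitsUpTo (𝒢 : Finset Gate) (w T : ℕ) : Finset (Circuit w) :=
  (Finset.range (T + 1)).biUnion fun l =>
    (Fintype.piFinset fun _ : Fin l => placedGates 𝒢 w).image List.ofFn

lemma mem_circuitsUpTo {𝒢 : Finset Gate} {w T : ℕ} {C : Circuit w} (h : C.Over 𝒢)
    (hT : C.length ≤ T) : C ∈ circuitsUpTo 𝒢 w T := by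
  classical
  refine Finset.mem_biUnion.2 ⟨C.length, Finset.mem_range.2 (by omega), ?_⟩
  refine Finset.mem_image.2 ⟨C.get, Fintype.mem_piFinset.2 fun i => ?_, List.ofFn_get C⟩
  exact mem_placedGates (h _ (List.get_mem C i))

lemma card_circuitsUpTo_le {𝒢 : Finset Gate} {w T K : ℕ} (hw : 0 < w)
    (hK : ∀ G ∈ 𝒢, G.arity ≤ K) :
    (circuitsUpTo 𝒢 w T).card ≤ (T + 1) * (𝒢.card * w ^ K + 1) ^ T := by
  classical
  refine (Finset.card_biUnion_le_card_mul _ _ ((𝒢.card * w ^ K + 1) ^ T) fun l hl => ?_).trans ?_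
  · refine Finset.card_image_le.trans ?_
    rw [Fintype.card_piFinset, Finset.prod_const, Finset.card_univ, Fintype.card_fin]
    have hl' : l ≤ T := by have := Finset.mem_range.1 hl; omega
    -- The `+ 1` keeps the base positive, so the power is monotone in the length even for empty `𝒢`.
    calc (placedGates 𝒢 w).card ^ l ≤ (𝒢.card * w ^ K + 1) ^ l :=
          Nat.pow_le_pow_left ((card_placedGates_le hw hK).trans (Nat.le_succ _)) _
      _ ≤ _ := Nat.pow_le_pow_right (Nat.succ_pos _) hl'
  · rw [Finset.card_range]

/-! ### Existence of a hard set -/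

/-- This is `4^M < M * centralBinom M` at `M = 2^(n-1)`, which needs `M ≥ 4`. -/
lemma card_balanced_ge {n : ℕ} (hn : 3 ≤ n) :
    2 ^ 2 ^ n ≤ 2 ^ n *
      ((Finset.univ : Finset (Fin n → Bool)).powersetCard (2 ^ n / 2)).card := by
  obtain ⟨k, rfl⟩ : ∃ k, n = k + 1 := ⟨n - 1, by omega⟩
  have h4 : 4 ≤ 2 ^ k := by
    calc 4 = 2 ^ 2 := rfl
      _ ≤ 2 ^ k := Nat.pow_le_pow_right (by norm_num) (by omega)
  have h := Nat.four_pow_lt_mul_centralBinom (2 ^ k) h4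
  have e : 2 ^ (k + 1) / 2 = 2 ^ k := by rw [pow_succ]; simp
  rw [Finset.card_powersetCard, Finset.card_univ, Fintype.card_fun, Fintype.card_bool,
    Fintype.card_fin, e]
  rw [Nat.centralBinom, ← pow_succ'] at h
  have e4 : 2 ^ 2 ^ (k + 1) = 4 ^ 2 ^ k := by
    rw [show (4 : ℕ) = 2 ^ 2 from rfl, ← pow_mul, ← pow_succ']
  rw [e4]
  exact h.le.trans (Nat.mul_le_mul_right _
    (Nat.pow_le_pow_right (by norm_num) (Nat.le_add_right k 1)))

lemma card_compl_of_balanced {n : ℕ} (hn : 1 ≤ n) {S : Finset (Fin n → Bool)}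
    (hS : S.card = 2 ^ n / 2) : Sᶜ.card = S.card := by
  obtain ⟨k, rfl⟩ : ∃ k, n = k + 1 := ⟨n - 1, by omega⟩
  rw [Finset.card_compl, hS, Fintype.card_fun, Fintype.card_bool, Fintype.card_fin, pow_succ]
  omega

/-- Union bound over circuits. In `h`, the factor 2 pays for the two-sided tail and `2 ^ n` for the
density of balanced sets. -/
lemma exists_hard_set {n : ℕ} (hn : 3 ≤ n) {𝒢 : Finset Gate} {K T : ℕ}
    (hK : ∀ G ∈ 𝒢, G.arity ≤ K) {δ : ℝ} (hδ : 0 ≤ δ)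
    (h : 2 * 2 ^ n * (((T * K + 1) * ((T + 1) * (𝒢.card * (n + T * K) ^ K + 1) ^ T) : ℕ) : ℝ)
      < Real.exp (δ ^ 2 * 2 ^ n / 8)) :
    ∃ S : Finset (Fin n → Bool), S.card = 2 ^ n / 2 ∧ ∀ (m : ℕ) (C : Circuit (n + m)),
      C.Over 𝒢 → C.length ≤ T →
      |probOne (C.run (withAncillas m (subsetState S)))
        - probOne (C.run (withAncillas m (subsetState Sᶜ)))| < δ := by
  classical
  by_contra! hcon
  let I : Finset (Σ m : ℕ, Circuit (n + m)) :=
    (Finset.range (T * K + 1)).sigma fun m => circuitsUpTo 𝒢 (n + m) T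
  have hI : I.card ≤ (T * K + 1) * ((T + 1) * (𝒢.card * (n + T * K) ^ K + 1) ^ T) := by
    rw [Finset.card_sigma]
    refine (Finset.sum_le_card_nsmul _ _ _ fun m hm => ?_).trans_eq
      (by rw [Finset.card_range, smul_eq_mul])
    refine (card_circuitsUpTo_le (by omega) hK).trans ?_
    have : m ≤ T * K := by have := Finset.mem_range.1 hm; omega
    gcongr
  let bad : (Σ m : ℕ, Circuit (n + m)) → Finset (Finset (Fin n → Bool)) := fun p =>
    Finset.univ.filter fun S => S.card = 2 ^ n / 2 ∧
      δ ≤ |probOne (p.2.run (withAncillas p.1 (subsetState S)))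
        - probOne (p.2.run (withAncillas p.1 (subsetState Sᶜ)))|
  have hN : (0 : ℝ) < 2 ^ n := by positivity
  have hhalf : (((2 ^ n / 2 : ℕ)) : ℝ) = 2 ^ n / 2 := by
    rw [Nat.cast_div (dvd_pow_self 2 (by omega)) (by norm_num)]
    push_cast; rfl
  have hbad : ∀ p, ((bad p).card : ℝ) ≤ 2 * 2 ^ 2 ^ n * Real.exp (-(δ ^ 2 * 2 ^ n / 8)) := by
    intro p
    obtain ⟨w, hw, hp⟩ := p.2.exists_weights
    -- The bias is the linear form divided by `|S| = N / 2`, hence this threshold.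
    have h1 := card_le_abs_sum_signVec_le w hN (t := δ * (2 ^ n / 2)) (by positivity) hw
    rw [Fintype.card_fun, Fintype.card_bool, Fintype.card_fin] at h1
    have e : (δ * (2 ^ n / 2)) ^ 2 / (2 * 2 ^ n) = δ ^ 2 * 2 ^ n / 8 := by
      field_simp; ring
    rw [e] at h1
    refine le_trans ?_ h1
    refine Nat.cast_le.2 (Finset.card_le_card fun S hS => ?_)
    obtain ⟨hS1, hS2⟩ := (Finset.mem_filter.1 hS).2
    rw [hp S (card_compl_of_balanced (by omega) hS1), hS1, hhalf, abs_div,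
      abs_of_pos (show (0 : ℝ) < 2 ^ n / 2 by positivity),
      le_div_iff₀ (by positivity)] at hS2
    exact Finset.mem_filter.2 ⟨Finset.mem_univ _, hS2⟩
  have hcover : (Finset.univ : Finset (Fin n → Bool)).powersetCard (2 ^ n / 2)
      ⊆ I.biUnion bad := by
    intro S hS
    have hS1 := (Finset.mem_powersetCard.1 hS).2
    obtain ⟨m, C, hC, hT, hd⟩ := hcon S hS1
    obtain ⟨m', hm', C', hC', hl, hprob⟩ := C.exists_few_ancillas (by omega) hK hC
    refine Finset.mem_biUnion.2 ⟨⟨m', C'⟩, ?_, ?_⟩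
    · refine Finset.mem_sigma.2 ⟨Finset.mem_range.2 ?_, mem_circuitsUpTo hC' (hl.trans_le hT)⟩
      exact Nat.lt_succ_of_le (hm'.trans (Nat.mul_le_mul_right K hT))
    · exact Finset.mem_filter.2 ⟨Finset.mem_univ _, hS1, by rw [← hprob, ← hprob]; exact hd⟩
  have h1 : (((Finset.univ : Finset (Fin n → Bool)).powersetCard (2 ^ n / 2)).card : ℝ)
      ≤ I.card * (2 * 2 ^ 2 ^ n * Real.exp (-(δ ^ 2 * 2 ^ n / 8))) := by
    refine (Nat.cast_le.2 ((Finset.card_le_card hcover).trans Finset.card_biUnion_le)).trans ?_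
    rw [Nat.cast_sum, ← nsmul_eq_mul]
    exact Finset.sum_le_card_nsmul _ _ _ fun p _ => hbad p
  have h2 : (2 : ℝ) ^ 2 ^ n ≤ 2 ^ n *
      (((Finset.univ : Finset (Fin n → Bool)).powersetCard (2 ^ n / 2)).card : ℝ) := by
    exact_mod_cast card_balanced_ge hn
  have h3 : (I.card : ℝ) ≤
      (((T * K + 1) * ((T + 1) * (𝒢.card * (n + T * K) ^ K + 1) ^ T) : ℕ) : ℝ) :=
    Nat.cast_le.2 hI
  have h4 : 2 * 2 ^ n * (I.card : ℝ) < Real.exp (δ ^ 2 * 2 ^ n / 8) :=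
    (mul_le_mul_of_nonneg_left h3 (by positivity)).trans_lt h
  have h5 := h2.trans (mul_le_mul_of_nonneg_left h1 hN.le)
  have hX : (0 : ℝ) < 2 ^ 2 ^ n := by positivity
  rw [Real.exp_neg] at h5
  have hE := Real.exp_pos (δ ^ 2 * 2 ^ n / 8)
  generalize Real.exp (δ ^ 2 * 2 ^ n / 8) = R at *
  have h6 : (2 : ℝ) ^ 2 ^ n * R ≤ 2 ^ 2 ^ n * (2 * 2 ^ n * (I.card : ℝ)) := by
    have := mul_le_mul_of_nonneg_right h5 hE.le
    refine this.trans_eq ?_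
    field_simp
  exact absurd (le_of_mul_le_mul_left h6 hX) (not_le.2 h4)

lemma eventually_pow_le_two_pow (c : ℝ) (k : ℕ) :
    ∀ᶠ n : ℕ in atTop, c * (n : ℝ) ^ k ≤ 2 ^ n := by
  have h := (isLittleO_pow_const_const_pow_of_one_lt (R := ℝ) k (one_lt_two)).const_mul_left c
  filter_upwards [h.bound one_pos] with n hn
  have := (le_abs_self _).trans hn
  simpa using this

/-- Every factor is at most a power of `N = 2 ^ n`; the 7 is `2 + 3 + 2`. -/
lemma circuit_count_le {n k T : ℕ} (g : ℕ) (hg : g ≤ n ^ k) (hn : 2 ≤ n)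
    (hk : n ^ k ≤ 2 ^ n) (hT : T ≤ 2 ^ n) :
    2 * 2 ^ n * ((T * n ^ k + 1) * ((T + 1) * (g * (n + T * n ^ k) ^ n ^ k + 1) ^ T))
      ≤ (2 ^ n) ^ (7 + T * (3 * n ^ k + 2)) := by
  have hN4 : 4 ≤ 2 ^ n := by
    calc 4 = 2 ^ 2 := rfl
      _ ≤ 2 ^ n := Nat.pow_le_pow_right (by norm_num) hn
  have hnN : n ≤ 2 ^ n := Nat.lt_two_pow_self.le
  generalize 2 ^ n = N at *
  generalize n ^ k = K at *
  have hTK : T * K ≤ N * N := Nat.mul_le_mul hT hk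
  have h1 : T * K + 1 ≤ N ^ 3 := by nlinarith
  have h2 : T + 1 ≤ N ^ 2 := by nlinarith
  have h3 : n + T * K ≤ N ^ 3 := by nlinarith
  have h4 : g * (n + T * K) ^ K + 1 ≤ N ^ (3 * K + 2) := by
    have hp : 1 ≤ (N ^ 3) ^ K := Nat.one_le_pow _ _ (by positivity)
    calc g * (n + T * K) ^ K + 1 ≤ N * (N ^ 3) ^ K + (N ^ 3) ^ K :=
          Nat.add_le_add (Nat.mul_le_mul (hg.trans hk) (Nat.pow_le_pow_left h3 _)) hp
      _ = (N + 1) * (N ^ 3) ^ K := by ring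
      _ ≤ N ^ 2 * (N ^ 3) ^ K := Nat.mul_le_mul_right _ (by nlinarith)
      _ = _ := by rw [← pow_mul, ← pow_add, add_comm]
  calc 2 * N * ((T * K + 1) * ((T + 1) * (g * (n + T * K) ^ K + 1) ^ T))
      ≤ N * N * (N ^ 3 * (N ^ 2 * (N ^ (3 * K + 2)) ^ T)) := by gcongr; omega
    _ = N ^ (7 + T * (3 * K + 2)) := by
      rw [← pow_mul, pow_add, mul_comm (3 * K + 2) T]; ring

lemma two_pow_pow_lt_exp {n k k' T : ℕ} {δ : ℝ} (hn : 160 ≤ n)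
    (hT : (T : ℝ) * (n : ℝ) ^ (2 * k' + k + 2) ≤ 2 ^ n)
    (hlarge : 224 * (n : ℝ) ^ (2 * k' + 1) ≤ 2 ^ n) (hδ : 1 / (n : ℝ) ^ k' ≤ δ) :
    (((2 ^ n) ^ (7 + T * (3 * n ^ k + 2)) : ℕ) : ℝ) < Real.exp (δ ^ 2 * 2 ^ n / 8) := by
  have hn0 : (160 : ℝ) ≤ n := by exact_mod_cast hn
  have hnpos : (0 : ℝ) < n := by linarith
  have hp : (0 : ℝ) < (n : ℝ) ^ (2 * k') := by positivity
  have hδ2 : 1 / (n : ℝ) ^ (2 * k') ≤ δ ^ 2 := by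
    have := pow_le_pow_left₀ (by positivity) hδ 2
    rwa [div_pow, one_pow, ← pow_mul, mul_comm k' 2] at this
  have hk1 : (1 : ℝ) ≤ (n : ℝ) ^ k := one_le_pow₀ (by linarith)
  have hexp : (n : ℝ) * (7 + T * (3 * (n : ℝ) ^ k + 2)) ≤ δ ^ 2 * 2 ^ n / 8 := by
    -- Each of the two summands is at most `N / 32`, whence `224 = 7 · 32` and `160 = 5 · 32`; the
    -- spare factor `n` in `hT` absorbs the latter.
    have hb : (n : ℝ) * (7 + T * (3 * (n : ℝ) ^ k + 2)) * (n : ℝ) ^ (2 * k') ≤ 2 ^ n / 16 := by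
      have a1 : (n : ℝ) * (n : ℝ) ^ (2 * k') * 7 ≤ 2 ^ n / 32 := by
        rw [pow_succ] at hlarge; linarith
      have a2 : (T : ℝ) * (3 * (n : ℝ) ^ k + 2) ≤ T * (5 * (n : ℝ) ^ k) :=
        mul_le_mul_of_nonneg_left (by linarith) (Nat.cast_nonneg _)
      have a3 : (n : ℝ) * (n : ℝ) ^ (2 * k') * (T * (5 * (n : ℝ) ^ k)) ≤ 2 ^ n / 32 := by
        have e : (T : ℝ) * (n : ℝ) ^ (2 * k' + k + 2)
            = n * ((n : ℝ) * (n : ℝ) ^ (2 * k') * (T * (n : ℝ) ^ k)) := by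
          rw [pow_add, pow_add]; ring
        rw [e] at hT
        have hq : (0 : ℝ) ≤ (n : ℝ) * (n : ℝ) ^ (2 * k') * (T * (n : ℝ) ^ k) := by positivity
        have := mul_le_mul_of_nonneg_right hn0 hq
        linarith
      have a4 := mul_le_mul_of_nonneg_left a2 (by positivity : 0 ≤ (n : ℝ) * (n : ℝ) ^ (2 * k'))
      linarith
    have hc : (2 : ℝ) ^ n / 16 / (n : ℝ) ^ (2 * k') ≤ δ ^ 2 * 2 ^ n / 8 := by
      have := mul_le_mul_of_nonneg_right hδ2 (by positivity : (0 : ℝ) ≤ 2 ^ n / 8)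
      have hq : (0 : ℝ) ≤ 2 ^ n / 16 / (n : ℝ) ^ (2 * k') := by positivity
      have e : 1 / (n : ℝ) ^ (2 * k') * (2 ^ n / 8) = 2 * (2 ^ n / 16 / (n : ℝ) ^ (2 * k')) := by
        field_simp; norm_num
      linarith
    exact ((le_div_iff₀ hp).2 hb).trans hc
  refine lt_of_lt_of_le ?_ (Real.exp_le_exp.2 hexp)
  have h2 : (2 : ℝ) < Real.exp 1 := by have := Real.exp_one_gt_d9; linarith
  push_cast
  rw [← pow_mul]
  calc (2 : ℝ) ^ (n * (7 + T * (3 * n ^ k + 2)))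
      < Real.exp 1 ^ (n * (7 + T * (3 * n ^ k + 2))) :=
        pow_lt_pow_left₀ h2 (by norm_num) (Nat.mul_ne_zero (by omega) (by omega))
    _ = _ := by rw [← Real.exp_nat_mul, mul_one]; push_cast; rfl

lemma lt_distComplexity_of_forall {𝒢 : Finset Gate} {n : ℕ} {ε : ℝ} {a b : QState n} {T : ℕ}
    (h : ∀ (m : ℕ) (C : Circuit (n + m)), C.Over 𝒢 → C.length ≤ T →
      |probOne (C.run (withAncillas m a)) - probOne (C.run (withAncillas m b))| < 1 - ε) :
    ((T + 1 : ℕ) : ℕ∞) ≤ distComplexity 𝒢 ε a b := by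
  refine le_sInf ?_
  rintro _ ⟨m, C, hC, hd, rfl⟩
  rw [Nat.cast_le]
  by_contra hlt
  exact absurd hd (not_le.2 (h m C hC (by omega)))

theorem mainTheorem8 (𝒢 : ℕ → Finset Gate) (h𝒢 : IsPolyGateFamily 𝒢)
    (ε : ℕ → ℝ) (hε_pos : ∀ n, 0 < ε n)
    (hε_omega : (fun n : ℕ => 1 / (2 : ℝ) ^ n) =o[atTop] ε)
    (hε_gap : ∃ k : ℕ, ∀ᶠ n : ℕ in atTop, 1 / (n : ℝ) ^ k ≤ 1 - ε n) :
    ∃ S : (n : ℕ) → Finset (Fin n → Bool),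
      (∀ n, 1 ≤ n → (S n).card = 2 ^ n / 2) ∧
      IsOmegaTilde
        (fun n => distComplexity (𝒢 n) (ε n) (subsetState (S n)) (subsetState (S n)ᶜ))
        (fun n => (2 : ℝ) ^ n) := by
  classical
  obtain ⟨k, hk⟩ := h𝒢
  obtain ⟨k', hk'⟩ := hε_gap
  set j := 2 * k' + k + 2 with hj
  let good : (n : ℕ) → Finset (Fin n → Bool) → Prop := fun n S =>
    ∀ (m : ℕ) (C : Circuit (n + m)), C.Over (𝒢 n) → C.length ≤ ⌊(2 : ℝ) ^ n / (n : ℝ) ^ j⌋₊ →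
      |probOne (C.run (withAncillas m (subsetState S)))
        - probOne (C.run (withAncillas m (subsetState Sᶜ)))| < 1 - ε n
  -- Where no hard set exists, an arbitrary set of the right size is the default; this happens only
  -- for finitely many `n`.
  have hchoice : ∀ n, ∃ S : Finset (Fin n → Bool), S.card = 2 ^ n / 2 ∧
      ((∃ S : Finset (Fin n → Bool), S.card = 2 ^ n / 2 ∧ good n S) → good n S) := by
    intro n
    by_cases h : ∃ S : Finset (Fin n → Bool), S.card = 2 ^ n / 2 ∧ good n S
    · obtain ⟨S, h1, h2⟩ := h
      exact ⟨S, h1, fun _ => h2⟩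
    · obtain ⟨S, -, hS⟩ := Finset.exists_subset_card_eq
        (s := (Finset.univ : Finset (Fin n → Bool))) (n := 2 ^ n / 2) (by
          rw [Finset.card_univ, Fintype.card_fun, Fintype.card_bool, Fintype.card_fin]
          exact Nat.div_le_self _ _)
      exact ⟨S, hS, fun h' => absurd h' h⟩
  choose S hcard hgood using hchoice
  -- Since `log N = n log 2`, this constant turns the bound into exactly `N / n^j`.
  refine ⟨S, fun n _ => hcard n, Real.log 2 ^ j, by positivity, j, ?_⟩
  filter_upwards [hk, hk', eventually_ge_atTop 160, eventually_pow_le_two_pow 1 k,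
    eventually_pow_le_two_pow 224 (2 * k' + 1)] with n hkn hk'n hn hkN hlarge
  set T := ⌊(2 : ℝ) ^ n / (n : ℝ) ^ j⌋₊ with hTdef
  have hn1 : (1 : ℝ) ≤ n := by exact_mod_cast (by omega : 1 ≤ n)
  have hnj : (1 : ℝ) ≤ (n : ℝ) ^ j := one_le_pow₀ hn1
  have hTle : (T : ℝ) ≤ 2 ^ n / (n : ℝ) ^ j := Nat.floor_le (by positivity)
  have hTmul : (T : ℝ) * (n : ℝ) ^ j ≤ 2 ^ n := (le_div_iff₀ (by positivity)).1 hTle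
  have hTN : T ≤ 2 ^ n := by
    have : (T : ℝ) ≤ 2 ^ n := hTle.trans (div_le_self (by positivity) hnj)
    exact_mod_cast this
  have hkN' : n ^ k ≤ 2 ^ n := by
    rw [one_mul] at hkN
    exact_mod_cast hkN
  have hδ : 0 ≤ 1 - ε n := le_trans (by positivity) hk'n
  have hcount := circuit_count_le (𝒢 n).card hkn.1 (by omega) hkN' hTN
  have hex : ∃ S : Finset (Fin n → Bool), S.card = 2 ^ n / 2 ∧ good n S := by
    refine exists_hard_set (T := T) (by omega) hkn.2 hδ ?_
    refine lt_of_le_of_lt ?_ (two_pow_pow_lt_exp hn hTmul hlarge hk'n)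
    generalize T = t at hcount
    exact_mod_cast hcount
  have hlow := lt_distComplexity_of_forall (hgood n hex)
  have hle : Real.log 2 ^ j * 2 ^ n / Real.log ((2 : ℝ) ^ n) ^ j ≤ ((T + 1 : ℕ) : ℝ) := by
    have hlog : 0 < Real.log 2 := Real.log_pos one_lt_two
    have e : Real.log 2 ^ j * 2 ^ n / Real.log ((2 : ℝ) ^ n) ^ j = 2 ^ n / (n : ℝ) ^ j := by
      rw [Real.log_pow, mul_pow]
      field_simp
    rw [e]
    push_cast
    exact (Nat.lt_floor_add_one _).le
  calc ENNReal.ofReal (Real.log 2 ^ j * 2 ^ n / Real.log ((2 : ℝ) ^ n) ^ j)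
      ≤ ENNReal.ofReal ((T + 1 : ℕ) : ℝ) := ENNReal.ofReal_le_ofReal hle
    _ = (((T + 1 : ℕ) : ℕ∞) : ℝ≥0∞) := by rw [ENNReal.ofReal_natCast, ENat.toENNReal_coe]
    _ ≤ _ := ENat.toENNReal_le.2 hlow
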